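/- Let $n\ge 0$, let $\mathfrak{gl}_n=\mathfrak{gl}_n(\mathbb C)$ with its basis of matrix units $E_{ij}$ and the commutator bracket $[E_{ij},E_{kl}]=\delta_{kj}E_{il}-\delta_{il}E_{kj}$, and let $\mathrm U(\mathfrak{gl}_n)$ be its universal enveloping algebra. Let $E$ be the $n\times n$ matrix over $\mathrm U(\mathfrak{gl}_n)$ whose $(i,j)$ entry is $E_{ij}$, and let $E^t$ be its transpose, $(E^t)_{ij}=E_{ji}$. The Capelli determinant is the polynomial in $u$ with coefficients in $\mathrm U(\mathfrak{gl}_n)$ $$C(u)=\sum_{p\in\mathfrak S_n}\operatorname{sgn}p\cdot (u+E)_{p(1),1}\,(u+E-1)_{p(2),2}\cdots(u+E-n+1)_{p(n),n}.$$ For a matrix $A$ over $\mathrm U(\mathfrak{gl}_n)$ and $C(u)=\sum_k C_k u^k$, put $C(A)=\sum_k C_k A^k$, where $C_k$ stands for the scalar matrix with diagonal entries $C_k$. A scalar that is added to a matrix stands for the corresponding multiple of the identity matrix. **Theorem.** The coefficients of $C(u)$ belong to the center of $\mathrm U(\mathfrak{gl}_n)$, and $$C(-E+n-1)=0\qquad\text{and}\qquad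 C(-E^{t})=0.$$ Consequently, let $L$ be a highest weight representation of $\mathfrak{gl}_n$ with highest weight $(\lambda_1,\dots,\lambda_n)\in\mathbb C^n$; that is, $L$ is generated by a nonzero vector $v$ with $E_{ij}v=0$ for $i<j$ and $E_{ii}v=\lambda_i v$ for all $i$. Put $l_i=\lambda_i-i+1$ for $1\le i\le n$. Then the image of the matrix $E$ in $L$, a matrix with entries in $\operatorname{End}L$, satisfies $$\prod_{i=1}^n(E-l_i-n+1)=0\qquad\text{and}\qquad\prod_{i=1}^n(E^{t}-l_i)=0 .$$ -/

import Mathlib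

open Polynomial Matrix

attribute [local instance 100] LieRing.ofAssociativeRing

noncomputable section

namespace CapelliCH

/-- The general linear Lie algebra of complex `n × n` matrices, with the commutator bracket. -/
abbrev gl (n : ℕ) : Type := Matrix (Fin n) (Fin n) ℂ

/-- The universal enveloping algebra of `gl n`. -/
abbrev U (n : ℕ) : Type := UniversalEnvelopingAlgebra ℂ (gl n)

/-- The generator matrix `E`: its `(i, j)` entry is the matrix unit `E_ij`, seen in `U n`. -/
def genMatrix (n : ℕ) : Matrix (Fin n) (Fin n) (U n) :=
  Matrix.of fun i j => UniversalEnvelopingAlgebra.ι ℂ (Matrix.single i j (1 : ℂ) : gl n)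

/-- The matrix `u + E - k` over `U n [u]`, where `u` is the (central) polynomial variable. -/
def shiftedMatrix (n k : ℕ) : Matrix (Fin n) (Fin n) (U n)[X] :=
  Matrix.scalar (Fin n) X + (genMatrix n).map C - (k : Matrix (Fin n) (Fin n) (U n)[X])

/-- The Capelli determinant
`C(u) = ∑ p, sgn p * (u + E)_{p(1),1} * (u + E - 1)_{p(2),2} * ⋯ * (u + E - n + 1)_{p(n),n}`,
the noncommutative product being taken from left to right.
Indices run through `0, …, n - 1`, so that the factor in column `k` is taken from `u + E - k`. -/
def capelliDet (n : ℕ) : (U n)[X] :=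
  ∑ p : Equiv.Perm (Fin n), ((Equiv.Perm.sign p : ℤ) : (U n)[X]) *
    (List.ofFn fun k : Fin n => shiftedMatrix n k (p k) k).prod

/-- The value `P(A) = ∑ k, P_k A ^ k` of a polynomial `P` with coefficients `P_k` in `U n` at a
matrix `A` over `U n`; a coefficient is identified with the corresponding scalar matrix. -/
def evalMatrix {n : ℕ} (P : (U n)[X]) (A : Matrix (Fin n) (Fin n) (U n)) :
    Matrix (Fin n) (Fin n) (U n) :=
  P.eval₂ (Matrix.scalar (Fin n)) A

section Rep

variable {n : ℕ} (V : Type*) [AddCommGroup V] [Module ℂ V] [LieRingModule (gl n) V]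
  [LieModule ℂ (gl n) V]

/-- The image of the generator matrix in a representation `V`, a matrix over `End V`:
each entry is sent through the action `U n → End V` of the enveloping algebra. -/
def genMatrixOn : Matrix (Fin n) (Fin n) (Module.End ℂ V) :=
  (genMatrix n).map (UniversalEnvelopingAlgebra.lift ℂ (LieModule.toEnd ℂ (gl n) V))

/-- `V` is a highest weight representation with highest weight `lam`: it is generated by a nonzero
vector `v` such that `E_ij v = 0` for `i < j` and `E_ii v = lam i • v`. -/
def IsHighestWeightRep (lam : Fin n → ℂ) : Prop :=
  ∃ v : V, v ≠ 0 ∧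
    (∀ i j : Fin n, i < j → ⁅(Matrix.single i j (1 : ℂ) : gl n), v⁆ = 0) ∧
    (∀ i : Fin n, ⁅(Matrix.single i i (1 : ℂ) : gl n), v⁆ = lam i • v) ∧
    LieSubmodule.lieSpan ℂ (gl n) {v} = ⊤

end Rep

/-- `l_i = λ_i - i + 1` for `i = 1, …, n`; the index `i : Fin n` stands for `i + 1`. -/
def shiftedWeight {n : ℕ} (lam : Fin n → ℂ) (i : Fin n) : ℂ :=
  lam i - ((i : ℕ) + 1 : ℂ) + 1

end CapelliCH

end

/-! The shifts by 0, 1, …, n - 1 in the Capelli determinant are exactly what restores the usual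
behaviour of a determinant under column permutations. For consecutive columns, the commutators of
the `E_ij` cancel against the unit difference of the shifts (`shifted_column_exchange`). Hence the
column determinant is antisymmetric in its columns and vanishes when two coincide, while
antisymmetry in the rows is built into the sum over permutations. Since `[E_ab, ·]` replaces one row
or one column by another, both contributions equal `δ_ab C(u)`, and `C(u)` is central.

Expansion with an alien column gives Cramer's rule, but only at the two ends of the ordered product,
where a factor can be pulled out: `N (u + E - n + 1) = C(u)` from the last column and `(u + E)ᵗ N' =
C(u)` from the first. A noncommutative factor theorem turns these into the two Cayley-Hamilton
identities.

On a highest weight vector only the identity permutation survives, so `C(u)` acts as `∏ (u + l_i)`.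
Centrality spreads this to all of `L`, and the identities become products of linear factors. -/

namespace CapelliCH

/-! ### Ordered products in a noncommutative ring -/

section ListProducts

variable {A : Type*} [Ring A]

/-- `L` and `R` depend on `g` alone, so products differing only in position `k` can be compared
through that one factor. -/
theorem exists_prod_ofFn_eq_mul_apply_mul :
    ∀ {n : ℕ} (g : Fin n → A) (k : Fin n), ∃ L R : A, ∀ f : Fin n → A,
      (∀ m, m ≠ k → f m = g m) → (List.ofFn f).prod = L * f k * R
  | 0, _, k => k.elim0
  | n + 1, g, k => by
    refine Fin.cases ?_ (fun k => ?_) k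
    · refine ⟨1, (List.ofFn fun i : Fin n => g i.succ).prod, fun f hf => ?_⟩
      have : (fun i : Fin n => f i.succ) = fun i => g i.succ :=
        funext fun i => hf _ (Fin.succ_ne_zero i)
      rw [List.ofFn_succ, List.prod_cons, this, one_mul]
    · obtain ⟨L, R, h⟩ := exists_prod_ofFn_eq_mul_apply_mul (fun i => g i.succ) k
      refine ⟨g 0 * L, R, fun f hf => ?_⟩
      rw [List.ofFn_succ, List.prod_cons, hf 0 (Fin.succ_ne_zero k).symm,
        h (fun i => f i.succ) fun m hm => hf _ fun e => hm (Fin.succ_injective _ e)]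
      simp only [mul_assoc]

theorem exists_prod_ofFn_eq_mul_apply_mul_apply_mul :
    ∀ {n : ℕ} (g : Fin (n + 1) → A) (k : Fin n), ∃ L R : A, ∀ f : Fin (n + 1) → A,
      (∀ m, m ≠ k.castSucc → m ≠ k.succ → f m = g m) →
        (List.ofFn f).prod = L * (f k.castSucc * f k.succ) * R
  | 0, _, k => k.elim0
  | n + 1, g, k => by
    refine Fin.cases ?_ (fun k => ?_) k
    · refine ⟨1, (List.ofFn fun i : Fin n => g i.succ.succ).prod, fun f hf => ?_⟩
      have : (fun i : Fin n => f i.succ.succ) = fun i => g i.succ.succ :=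
        funext fun i => hf _ (Fin.succ_ne_zero _)
          fun e => Fin.succ_ne_zero _ (Fin.succ_injective _ e)
      rw [List.ofFn_succ, List.ofFn_succ, List.prod_cons, List.prod_cons, this, one_mul,
        mul_assoc]
      rfl
    · obtain ⟨L, R, h⟩ := exists_prod_ofFn_eq_mul_apply_mul_apply_mul (fun i => g i.succ) k
      refine ⟨g 0 * L, R, fun f hf => ?_⟩
      rw [List.ofFn_succ, List.prod_cons, hf 0 (by simp [Fin.ext_iff]) (Fin.succ_ne_zero _).symm,
        h (fun i => f i.succ) fun m hm hm' => hf _ (fun e => hm (Fin.succ_injective _ e))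
          fun e => hm' (Fin.succ_injective _ e)]
      simp only [mul_assoc, Fin.succ_castSucc]

/-- The Leibniz rule for the commutator with a product. -/
theorem mul_prod_ofFn_sub_prod_ofFn_mul (e : A) :
    ∀ {n : ℕ} (f : Fin n → A),
      e * (List.ofFn f).prod - (List.ofFn f).prod * e =
        ∑ k, (List.ofFn (Function.update f k (e * f k - f k * e))).prod
  | 0, f => by simp
  | n + 1, f => by
    have ih := mul_prod_ofFn_sub_prod_ofFn_mul e fun i : Fin n => f i.succ
    have h0 : ∀ (a : A) (i : Fin n), Function.update f 0 a i.succ = f i.succ := fun a i =>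
      Function.update_of_ne (Fin.succ_ne_zero i) _ _
    have h1 : ∀ (k : Fin n) (a : A), (fun i : Fin n => Function.update f k.succ a i.succ) =
        Function.update (fun i : Fin n => f i.succ) k a := fun k a => by
      funext i
      by_cases h : i = k
      · subst h; simp
      · rw [Function.update_of_ne h, Function.update_of_ne fun e => h (Fin.succ_injective _ e)]
    have h2 : ∀ (k : Fin n) (a : A), Function.update f k.succ a 0 = f 0 := fun k a =>
      Function.update_of_ne (Fin.succ_ne_zero k).symm _ _
    simp only [Fin.sum_univ_succ, List.ofFn_succ, List.prod_cons, Function.update_self, h0, h1, h2,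
      ← Finset.mul_sum, ← ih]
    noncomm_ring

end ListProducts

/-! ### Column determinants: antisymmetry, cofactors, centrality -/

section ColumnDeterminant

variable {A : Type*} [Ring A] {n : ℕ}

/-- The product, in the order of the positions `k`, of the entries of `M k` in row `r k` and
column `c k`. -/
def entryProd (M : Fin n → Matrix (Fin n) (Fin n) A) (r c : Fin n → Fin n) : A :=
  (List.ofFn fun k => M k (r k) (c k)).prod

/-- The column determinant of the matrix whose `k`-th column is column `c k` of `M k`. -/
def columnDet (M : Fin n → Matrix (Fin n) (Fin n) A) (c : Fin n → Fin n) : A :=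
  ∑ p : Equiv.Perm (Fin n), ((Equiv.Perm.sign p : ℤ) : A) * entryProd M p c

/-- Pairing `p` with `p * s` gives opposite signs and interchanges the two rows in positions `k`, `k
+ 1`. The four resulting terms are the two sides of `hM`, with opposite signs and common outer
factors. -/
theorem columnDet_comp_swap_succ {n : ℕ} (M : Fin (n + 1) → Matrix (Fin (n + 1)) (Fin (n + 1)) A)
    (k : Fin n)
    (hM : ∀ a b j l, M k.castSucc a j * M k.succ b l + M k.castSucc a l * M k.succ b j =
      M k.castSucc b j * M k.succ a l + M k.castSucc b l * M k.succ a j)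
    (c : Fin (n + 1) → Fin (n + 1)) :
    columnDet M (c ∘ Equiv.swap k.castSucc k.succ) = - columnDet M c := by
  have hne : k.castSucc ≠ k.succ := Fin.castSucc_lt_succ.ne
  set s := Equiv.swap k.castSucc k.succ with hs
  rw [eq_neg_iff_add_eq_zero, columnDet, columnDet, ← Finset.sum_add_distrib]
  refine Finset.sum_involution (fun p _ => p * s) (fun p _ => ?_) (fun p _ _ h => ?_)
    (fun p _ => Finset.mem_univ _) (fun p _ => ?_)
  · obtain ⟨L, R, h⟩ := exists_prod_ofFn_eq_mul_apply_mul_apply_mul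
      (fun m => M m (p m) (c m)) k
    have hm : ∀ m, m ≠ k.castSucc → m ≠ k.succ → s m = m := fun m h1 h2 =>
      Equiv.swap_apply_of_ne_of_ne h1 h2
    have e1 : s k.castSucc = k.succ := Equiv.swap_apply_left _ _
    have e2 : s k.succ = k.castSucc := Equiv.swap_apply_right _ _
    simp only [entryProd]
    rw [h (fun m => M m (p m) ((c ∘ s) m)) fun m h1 h2 => by simp [hm m h1 h2],
      h (fun m => M m (p m) (c m)) fun m h1 h2 => rfl,
      h (fun m => M m ((p * s) m) ((c ∘ s) m)) fun m h1 h2 => by simp [hm m h1 h2],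
      h (fun m => M m ((p * s) m) (c m)) fun m h1 h2 => by simp [hm m h1 h2]]
    have e3 : Equiv.Perm.sign s = -1 := Equiv.Perm.sign_swap hne
    simp only [Equiv.Perm.mul_apply, Function.comp_apply, e1, e2, Equiv.Perm.sign_mul, e3]
    simp only [← mul_add, ← add_mul]
    rw [hM (p k.castSucc) (p k.succ) (c k.succ) (c k.castSucc)]
    simp
  · have := congrArg (fun q : Equiv.Perm (Fin (n + 1)) => p⁻¹ * q) h
    simp only [inv_mul_cancel_left, inv_mul_cancel] at this
    exact hne (Equiv.swap_eq_one_iff.mp this)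
  · simp [mul_assoc, hs]

theorem columnDet_comp_perm (M : Fin n → Matrix (Fin n) (Fin n) A)
    (hM : ∀ k l : Fin n, (k : ℕ) + 1 = l → ∀ a b i j, M k a i * M l b j + M k a j * M l b i =
      M k b i * M l a j + M k b j * M l a i)
    (s : Equiv.Perm (Fin n)) (c : Fin n → Fin n) :
    columnDet M (c ∘ s) = ((Equiv.Perm.sign s : ℤ) : A) * columnDet M c := by
  cases n with
  | zero =>
    rw [Subsingleton.elim s 1]
    simp
  | succ n =>
    have hs : s ∈ Submonoid.closure
        (Set.range fun i : Fin n => Equiv.swap i.castSucc i.succ) := by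
      rw [Equiv.Perm.mclosure_swap_castSucc_succ]
      trivial
    induction hs using Submonoid.closure_induction generalizing c with
    | mem s hs =>
      obtain ⟨k, rfl⟩ := hs
      have := columnDet_comp_swap_succ M k (hM k.castSucc k.succ (by simp)) c
      simp [this, Equiv.Perm.sign_swap (Fin.castSucc_lt_succ (i := k)).ne]
    | one => simp
    | mul s t _ _ hs ht =>
      have : c ∘ ⇑(s * t) = (c ∘ s) ∘ t := rfl
      rw [this, ht, hs, Equiv.Perm.sign_mul, mul_comm (Equiv.Perm.sign s), Units.val_mul,
        Int.cast_mul, mul_assoc]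

theorem columnDet_eq_zero_of_eq [IsAddTorsionFree A] (M : Fin n → Matrix (Fin n) (Fin n) A)
    (hM : ∀ k l : Fin n, (k : ℕ) + 1 = l → ∀ a b i j, M k a i * M l b j + M k a j * M l b i =
      M k b i * M l a j + M k b j * M l a i)
    (c : Fin n → Fin n) {k l : Fin n} (hkl : k ≠ l) (hc : c k = c l) : columnDet M c = 0 := by
  have h := columnDet_comp_perm M hM (Equiv.swap k l) c
  have : c ∘ Equiv.swap k l = c := by
    funext m
    rcases eq_or_ne m k with rfl | h1
    · simp [hc]
    rcases eq_or_ne m l with rfl | h2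
    · simp [hc]
    simp [Equiv.swap_apply_of_ne_of_ne h1 h2]
  rw [this, Equiv.Perm.sign_swap hkl] at h
  simpa [self_eq_neg] using h

/-- The signed sum over the permutations with `p k = i`, the factor in position `k` removed: the
cofactor of `columnDet M c` at row `i` and position `k`. -/
def columnCofactor (M : Fin n → Matrix (Fin n) (Fin n) A) (c : Fin n → Fin n) (k i : Fin n) : A :=
  ∑ p : Equiv.Perm (Fin n) with p k = i, ((Equiv.Perm.sign p : ℤ) : A) *
    (List.ofFn (Function.update (fun m => M m (p m) (c m)) k 1)).prod

/-- A cofactor never reads the column at its own position. One set of cofactors therefore serves all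
alien columns `j`, so the expansions assemble into a matrix product. -/
theorem columnCofactor_update (M : Fin n → Matrix (Fin n) (Fin n) A) (c : Fin n → Fin n)
    (k i j : Fin n) : columnCofactor M (Function.update c k j) k i = columnCofactor M c k i := by
  refine Finset.sum_congr rfl fun p _ => ?_
  congr 3
  funext m
  rcases eq_or_ne m k with rfl | h
  · simp
  · simp [h]

theorem columnDet_eq_sum_zero {n : ℕ} (M : Fin (n + 1) → Matrix (Fin (n + 1)) (Fin (n + 1)) A)
    (c : Fin (n + 1) → Fin (n + 1)) :
    columnDet M c = ∑ i, M 0 i (c 0) * columnCofactor M c 0 i := by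
  rw [columnDet, ← Finset.sum_fiberwise Finset.univ fun p : Equiv.Perm (Fin (n + 1)) => p 0]
  refine Finset.sum_congr rfl fun i _ => ?_
  rw [columnCofactor, Finset.mul_sum]
  refine Finset.sum_congr rfl fun p hp => ?_
  obtain rfl : p 0 = i := by simpa using hp
  rw [entryProd, List.ofFn_succ, List.ofFn_succ, List.prod_cons, List.prod_cons,
    Function.update_self, one_mul, ← mul_assoc, ← mul_assoc, Int.cast_comm]
  simp

theorem columnDet_eq_sum_last {n : ℕ} (M : Fin (n + 1) → Matrix (Fin (n + 1)) (Fin (n + 1)) A)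
    (c : Fin (n + 1) → Fin (n + 1)) :
    columnDet M c =
      ∑ i, columnCofactor M c (Fin.last n) i * M (Fin.last n) i (c (Fin.last n)) := by
  rw [columnDet,
    ← Finset.sum_fiberwise Finset.univ fun p : Equiv.Perm (Fin (n + 1)) => p (Fin.last n)]
  refine Finset.sum_congr rfl fun i _ => ?_
  rw [columnCofactor, Finset.sum_mul]
  refine Finset.sum_congr rfl fun p hp => ?_
  obtain rfl : p (Fin.last n) = i := by simpa using hp
  simp only [entryProd, List.ofFn_succ_last, List.prod_append, List.prod_singleton,
    Function.update_self, mul_one, mul_assoc]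
  simp [Fin.castSucc_ne_last]

/-- Expansion of a column determinant along position `k`, with an alien column `j` put there. -/
theorem columnDet_update_swap [IsAddTorsionFree A] (M : Fin n → Matrix (Fin n) (Fin n) A)
    (hM : ∀ k l : Fin n, (k : ℕ) + 1 = l → ∀ a b i j, M k a i * M l b j + M k a j * M l b i =
      M k b i * M l a j + M k b j * M l a i) (k l j : Fin n) :
    ((Equiv.Perm.sign (Equiv.swap k l) : ℤ) : A) *
      columnDet M (Function.update (Equiv.swap k l) k j) =
      if j = l then columnDet M id else 0 := by
  split_ifs with h
  · subst h
    have : Function.update (Equiv.swap k j) k j = id ∘ Equiv.swap k j := by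
      funext m
      rcases eq_or_ne m k with rfl | h
      · simp
      · simp [h]
    rw [this, columnDet_comp_perm M hM, ← mul_assoc, ← Int.cast_mul, ← Units.val_mul,
      Int.units_mul_self]
    simp
  -- The arrangement `swap k l` puts column `l` in position `k`; any other `j` already stands
  -- elsewhere and is now repeated.
  · have hk : Equiv.swap k l j ≠ k := fun e => h
      ((Equiv.swap k l).injective (e.trans (Equiv.swap_apply_right k l).symm))
    rw [columnDet_eq_zero_of_eq M hM _ (k := k) (l := Equiv.swap k l j) hk.symm, mul_zero]
    simp [Function.update_of_ne hk]

/-- An element `e` that acts on the entries of all the `M k` as the matrix unit `E a b`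
commutes with the column determinant. -/
theorem commute_columnDet [IsAddTorsionFree A] (M : Fin n → Matrix (Fin n) (Fin n) A)
    (hM : ∀ k l : Fin n, (k : ℕ) + 1 = l → ∀ a b i j, M k a i * M l b j + M k a j * M l b i =
      M k b i * M l a j + M k b j * M l a i) (a b : Fin n) (e : A)
    (he : ∀ k i j, e * M k i j - M k i j * e =
      (if i = b then M k a j else 0) - if j = a then M k i b else 0) :
    Commute e (columnDet M id) := by
  -- By the Leibniz rule, only the factor in row `b` yields a row term, and only the one in column
  -- `a` a column term.
  have key : ∀ p : Equiv.Perm (Fin n), e * entryProd M p id - entryProd M p id * e =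
      entryProd M (Function.update p (p⁻¹ b) a) id
        - entryProd M p (Function.update id a b) := by
    intro p
    rw [entryProd, mul_prod_ofFn_sub_prod_ofFn_mul]
    have h : ∀ k, (List.ofFn (Function.update (fun m => M m (p m) (id m)) k
        (e * M k (p k) (id k) - M k (p k) (id k) * e))).prod =
        (if k = p⁻¹ b then entryProd M (Function.update p (p⁻¹ b) a) id else 0)
          - if k = a then entryProd M p (Function.update id a b) else 0 := by
      intro k
      obtain ⟨L, R, h⟩ := exists_prod_ofFn_eq_mul_apply_mul (fun m => M m (p m) (id m)) k
      have h1 : k = p⁻¹ b → entryProd M (Function.update p (p⁻¹ b) a) id = L * M k a k * R := by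
        intro hk
        rw [← hk, entryProd, h]
        · simp
        · intro m hm; simp [hm]
      have h2 : k = a → entryProd M p (Function.update id a b) = L * M k (p k) b * R := by
        intro hk
        rw [← hk, entryProd, h]
        · simp
        · intro m hm; simp [hm]
      rw [h _ fun m hm => Function.update_of_ne hm _ _, Function.update_self, he, mul_sub, sub_mul]
      congr 1
      · by_cases hk : k = p⁻¹ b
        · rw [if_pos hk, if_pos (Equiv.Perm.eq_inv_iff_eq.mp hk), h1 hk]; rfl
        · rw [if_neg hk, if_neg fun e => hk (Equiv.Perm.eq_inv_iff_eq.mpr e)]; simp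
      · simp only [id]
        split_ifs with hk
        · rw [h2 hk]
        · simp
    rw [Finset.sum_congr rfl fun k _ => h k, Finset.sum_sub_distrib]
    simp
  have hcol : columnDet M (Function.update id a b) = if b = a then columnDet M id else 0 := by
    have := columnDet_update_swap M hM a a b
    simpa using this
  have hrow : ∑ p : Equiv.Perm (Fin n), ((Equiv.Perm.sign p : ℤ) : A) *
      entryProd M (Function.update p (p⁻¹ b) a) id = if b = a then columnDet M id else 0 := by
    split_ifs with hab
    · subst hab
      refine Finset.sum_congr rfl fun p _ => ?_
      congr 2
      funext m
      rcases eq_or_ne m (p⁻¹ b) with rfl | h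
      · simp
      · rw [Function.update_of_ne h]
    -- Row `a` now occurs twice: `p` and `swap a b * p` give the same product with opposite signs.
    · refine Finset.sum_involution (fun p _ => Equiv.swap a b * p) (fun p _ => ?_)
        (fun p _ _ h => ?_) (fun p _ => Finset.mem_univ _) (fun p _ => ?_)
      · have : Function.update (⇑(Equiv.swap a b * p)) ((Equiv.swap a b * p)⁻¹ b) a =
            Function.update p (p⁻¹ b) a := by
          funext m
          have hm : (Equiv.swap a b * p)⁻¹ b = p⁻¹ a := by simp
          rw [hm]
          rcases eq_or_ne m (p⁻¹ a) with rfl | h1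
          · rw [Function.update_self, Function.update_of_ne]
            · simp
            · simpa using Ne.symm hab
          rw [Function.update_of_ne h1]
          rcases eq_or_ne m (p⁻¹ b) with rfl | h2
          · simp
          rw [Function.update_of_ne h2, Equiv.Perm.mul_apply,
            Equiv.swap_apply_of_ne_of_ne]
          · exact fun e => h1 (by rw [← e]; simp)
          · exact fun e => h2 (by rw [← e]; simp)
        rw [this, Equiv.Perm.sign_mul, Equiv.Perm.sign_swap (Ne.symm hab)]
        simp
      · exact hab (Equiv.swap_eq_one_iff.mp (mul_eq_right.mp h)).symm
      · simp [← mul_assoc]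
  rw [commute_iff_eq, ← sub_eq_zero, columnDet, Finset.mul_sum, Finset.sum_mul,
    ← Finset.sum_sub_distrib]
  calc _ = ∑ p : Equiv.Perm (Fin n), ((Equiv.Perm.sign p : ℤ) : A) *
        (e * entryProd M p id - entryProd M p id * e) :=
        Finset.sum_congr rfl fun p _ => by
          rw [mul_sub, ← mul_assoc, ← mul_assoc, ← mul_assoc, (Int.cast_commute _ e).eq]
    _ = 0 := by
      simp only [key, mul_sub, Finset.sum_sub_distrib, hrow]
      rw [← columnDet, hcol, sub_self]

end ColumnDeterminant

/-! ### Factor theorem over a noncommutative ring -/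

section FactorTheorem

variable {R : Type*} [Ring R] {n : ℕ}

theorem eval₂_scalar_monomial_apply (A : Matrix (Fin n) (Fin n) R) (k : ℕ) (a : R) (i j : Fin n) :
    (monomial k a).eval₂ (Matrix.scalar (Fin n)) A i j = a * (A ^ k) i j := by
  rw [eval₂_monomial, Matrix.scalar_apply, Matrix.diagonal_mul]

/-- For a monomial the sum telescopes: `a A ^ (k + 1) - a A A ^ k = 0`, with coefficients on the
left. -/
theorem sum_eval₂_scalar_mul_sub (A : Matrix (Fin n) (Fin n) R) (P : R[X]) (m j : Fin n) :
    ∑ l, (P * ((if m = l then X else 0) - C (A m l))).eval₂ (Matrix.scalar (Fin n)) A l j = 0 := by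
  induction P using Polynomial.induction_on' with
  | add p q hp hq => simp only [add_mul, eval₂_add, Matrix.add_apply, Finset.sum_add_distrib, hp,
      hq, add_zero]
  | monomial k a =>
    have h : ∀ l, ((monomial k a) * ((if m = l then X else 0) - C (A m l))).eval₂
        (Matrix.scalar (Fin n)) A l j =
        (if m = l then a * (A ^ (k + 1)) l j else 0) - a * (A m l * (A ^ k) l j) := by
      intro l
      rw [mul_sub, eval₂_sub, Matrix.sub_apply, monomial_mul_C, eval₂_scalar_monomial_apply,
        mul_assoc]
      split_ifs
      · rw [monomial_mul_X, eval₂_scalar_monomial_apply]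
      · simp
    simp only [h, Finset.sum_sub_distrib, Finset.sum_ite_eq, Finset.mem_univ, if_true,
      ← Finset.mul_sum, ← Matrix.mul_apply, ← pow_succ', sub_self]

/-- If `N (u - A) = P`, then `A` is a root of `P`, coefficients being written on the left. -/
theorem eval₂_scalar_eq_zero_of_mul_sub (A : Matrix (Fin n) (Fin n) R)
    (N : Matrix (Fin n) (Fin n) R[X]) (P : R[X])
    (h : N * (Matrix.scalar (Fin n) X - (C : R →+* R[X]).mapMatrix A) = Matrix.scalar (Fin n) P) :
    P.eval₂ (Matrix.scalar (Fin n)) A = 0 := by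
  ext i j
  have h1 : P.eval₂ (Matrix.scalar (Fin n)) A i j =
      ∑ l, ((Matrix.scalar (Fin n) P) i l).eval₂ (Matrix.scalar (Fin n)) A l j := by
    rw [Finset.sum_eq_single i]
    · simp
    · intro l _ hl; simp [Matrix.diagonal_apply_ne _ hl.symm]
    · simp
  rw [h1, ← h]
  simp only [Matrix.mul_apply, eval₂_finsetSum, Matrix.sum_apply]
  rw [Finset.sum_comm]
  refine Finset.sum_eq_zero fun m _ => ?_
  rw [← sum_eval₂_scalar_mul_sub A (N i m) m j]
  simp [Matrix.diagonal_apply]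

/-- The sum of the `(A ^ k) i l * P_k`, the coefficients `P_k` of `P` being on the right. -/
def rightCoeffEval (A : Matrix (Fin n) (Fin n) R) (i l : Fin n) : R[X] →+ R where
  toFun P := P.sum fun k a => (A ^ k) i l * a
  map_zero' := by simp
  map_add' P Q := Polynomial.sum_add_index P Q _ (by simp) (by simp [mul_add])

theorem rightCoeffEval_monomial (A : Matrix (Fin n) (Fin n) R) (i l : Fin n) (k : ℕ) (a : R) :
    rightCoeffEval A i l (monomial k a) = (A ^ k) i l * a :=
  Polynomial.sum_monomial_index _ _ (by simp)

theorem sum_rightCoeffEval_sub_mul (A : Matrix (Fin n) (Fin n) R) (P : R[X]) (i m : Fin n) :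
    ∑ l, rightCoeffEval A i l (((if l = m then X else 0) - C (A l m)) * P) = 0 := by
  induction P using Polynomial.induction_on' with
  | add p q hp hq => simp only [mul_add, map_add, Finset.sum_add_distrib, hp, hq, add_zero]
  | monomial k a =>
    have h : ∀ l, rightCoeffEval A i l (((if l = m then X else 0) - C (A l m)) * monomial k a) =
        (if l = m then (A ^ (k + 1)) i l * a else 0) - (A ^ k) i l * A l m * a := by
      intro l
      rw [sub_mul, map_sub, C_mul_monomial, rightCoeffEval_monomial, mul_assoc]
      split_ifs
      · rw [X_mul_monomial, rightCoeffEval_monomial]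
      · simp
    simp only [h, Finset.sum_sub_distrib, Finset.sum_ite_eq', Finset.mem_univ, if_true,
      ← Finset.sum_mul, ← Matrix.mul_apply, ← pow_succ, sub_self]

/-- If `(u - A) N = P` and the coefficients of `P` are central, then `A` is a root of `P`. -/
theorem eval₂_scalar_eq_zero_of_sub_mul (A : Matrix (Fin n) (Fin n) R)
    (N : Matrix (Fin n) (Fin n) R[X]) (P : R[X]) (hP : ∀ k a, Commute (P.coeff k) a)
    (h : (Matrix.scalar (Fin n) X - (C : R →+* R[X]).mapMatrix A) * N = Matrix.scalar (Fin n) P) :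
    P.eval₂ (Matrix.scalar (Fin n)) A = 0 := by
  ext i j
  -- A left factor `u - A` is killed by evaluation with coefficients on the right; centrality of `P`
  -- makes both evaluations agree.
  have h0 : P.eval₂ (Matrix.scalar (Fin n)) A i j = rightCoeffEval A i j P := by
    rw [eval₂_eq_sum, Polynomial.sum, Matrix.sum_apply]
    refine Finset.sum_congr rfl fun k _ => ?_
    rw [Matrix.scalar_apply, Matrix.diagonal_mul, (hP k _).eq]
  have h1 : rightCoeffEval A i j P =
      ∑ l, rightCoeffEval A i l ((Matrix.scalar (Fin n) P) l j) := by
    rw [Finset.sum_eq_single j]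
    · simp
    · intro l _ hl; simp [Matrix.diagonal_apply_ne _ hl]
    · simp
  rw [h0, h1, ← h]
  simp only [Matrix.mul_apply, map_sum]
  rw [Finset.sum_comm]
  refine Finset.sum_eq_zero fun m _ => ?_
  rw [← sum_rightCoeffEval_sub_mul A (N m j) i m]
  simp [Matrix.diagonal_apply]

end FactorTheorem

/-! ### Commutation relations of shifted generators -/

section Commutation

variable {A : Type*} [Ring A] {n : ℕ}

/-- The difference of the two sides is a sum of two commutators, four terms linear in `x`; the `-1`
in `z - 1` produces their negatives. -/
theorem shifted_column_exchange (x : Matrix (Fin n) (Fin n) A)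
    (hx : ∀ a b j l, x a j * x b l - x b l * x a j =
      (if j = b then x a l else 0) - if a = l then x b j else 0)
    (z : A) (hz : ∀ y, Commute z y) (a b i j : Fin n) :
    (x a i + if a = i then z else 0) * (x b j + if b = j then z - 1 else 0) +
      (x a j + if a = j then z else 0) * (x b i + if b = i then z - 1 else 0) =
    (x b i + if b = i then z else 0) * (x a j + if a = j then z - 1 else 0) +
      (x b j + if b = j then z else 0) * (x a i + if a = i then z - 1 else 0) := by
  have h1 := sub_eq_iff_eq_add.mp (hx a b i j)
  have h2 := sub_eq_iff_eq_add.mp (hx a b j i)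
  simp only [add_mul, mul_add, h1, h2, eq_comm (a := i) (b := b), eq_comm (a := j) (b := b)]
  split_ifs <;> simp only [mul_sub, sub_mul, mul_one, one_mul, mul_zero, zero_mul, add_zero,
    zero_add, sub_zero, (hz _).eq] <;> abel

/-- The central shift drops out on the left, and on the right its two contributions cancel. -/
theorem commutator_shifted (x : Matrix (Fin n) (Fin n) A)
    (hx : ∀ a b j l, x a j * x b l - x b l * x a j =
      (if j = b then x a l else 0) - if a = l then x b j else 0)
    (z : A) (hz : ∀ y, Commute z y) (a b i j : Fin n) :
    x a b * (x i j + if i = j then z else 0) - (x i j + if i = j then z else 0) * x a b =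
      (if i = b then x a j + (if a = j then z else 0) else 0)
        - if j = a then x i b + (if i = b then z else 0) else 0 := by
  have h1 := sub_eq_iff_eq_add.mp (hx a i b j)
  simp only [add_mul, mul_add, h1, eq_comm (a := b) (b := i), eq_comm (a := a) (b := j)]
  split_ifs <;> simp_all [(hz _).eq]

end Commutation

/-! ### Centrality and the Cayley-Hamilton identities -/

section Capelli

variable (n : ℕ)

theorem genMatrix_commutator (a b j l : Fin n) :
    genMatrix n a j * genMatrix n b l - genMatrix n b l * genMatrix n a j =
      (if j = b then genMatrix n a l else 0) - if a = l then genMatrix n b j else 0 := by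
  have h := (UniversalEnvelopingAlgebra.ι ℂ).map_lie
    (Matrix.single a j (1 : ℂ) : gl n) (Matrix.single b l (1 : ℂ) : gl n)
  rw [LieRing.of_associative_ring_bracket, LieRing.of_associative_ring_bracket, map_sub] at h
  simp only [genMatrix, Matrix.of_apply]
  rw [← h]
  congr 1
  · split_ifs with e
    · subst e; simp
    · rw [Matrix.single_mul_single_of_ne _ _ _ _ e, map_zero]
  · split_ifs with e
    · subst e; simp
    · rw [Matrix.single_mul_single_of_ne _ _ _ _ (Ne.symm e), map_zero]

theorem mapGenMatrix_commutator (a b j l : Fin n) :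
    (genMatrix n).map C a j * (genMatrix n).map C b l
        - (genMatrix n).map C b l * (genMatrix n).map C a j =
      (if j = b then (genMatrix n).map (C : U n → (U n)[X]) a l else 0)
        - if a = l then (genMatrix n).map C b j else 0 := by
  simp only [Matrix.map_apply]
  rw [← C_mul, ← C_mul, ← C_sub, genMatrix_commutator, C_sub]
  split_ifs <;> simp

theorem shiftedMatrix_apply (k : ℕ) (i j : Fin n) :
    shiftedMatrix n k i j =
      (genMatrix n).map C i j + if i = j then (X - (k : (U n)[X])) else 0 := by
  have h : ((k : Matrix (Fin n) (Fin n) (U n)[X])) i j = if i = j then (k : (U n)[X]) else 0 := by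
    rw [← Matrix.diagonal_natCast, Matrix.diagonal_apply]
  rw [shiftedMatrix, Matrix.sub_apply, Matrix.add_apply, h, Matrix.scalar_apply,
    Matrix.diagonal_apply]
  split_ifs <;> abel

theorem X_sub_natCast_commute (k : ℕ) (y : (U n)[X]) : Commute (X - (k : (U n)[X])) y :=
  (commute_X y).sub_left (Nat.cast_commute k y)

theorem shiftedMatrix_exchange (k l : Fin n) (h : (k : ℕ) + 1 = l) (a b i j : Fin n) :
    shiftedMatrix n k a i * shiftedMatrix n l b j + shiftedMatrix n k a j * shiftedMatrix n l b i =
      shiftedMatrix n k b i * shiftedMatrix n l a j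
        + shiftedMatrix n k b j * shiftedMatrix n l a i := by
  have e : X - ((l : ℕ) : (U n)[X]) = X - ((k : ℕ) : (U n)[X]) - 1 := by
    rw [← h]; push_cast; abel
  simp only [shiftedMatrix_apply, e]
  exact shifted_column_exchange _ (mapGenMatrix_commutator n) _ (X_sub_natCast_commute n k) _ _ _ _

theorem capelliDet_eq_columnDet :
    capelliDet n = columnDet (fun k : Fin n => shiftedMatrix n k) id := rfl

instance : IsAddTorsionFree (U n)[X] :=
  letI := Module.compHom (U n)[X] (algebraMap ℚ ℂ)
  .of_module_rat _

theorem commute_coeff_capelliDet_genMatrix (k : ℕ) (a b : Fin n) :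
    Commute ((capelliDet n).coeff k) (genMatrix n a b) := by
  have h := commute_columnDet (fun k : Fin n => shiftedMatrix n k) (shiftedMatrix_exchange n) a b
    (C (genMatrix n a b)) fun k i j => by
      simp only [shiftedMatrix_apply]
      exact commutator_shifted _ (mapGenMatrix_commutator n) _ (X_sub_natCast_commute n k) _ _ _ _
  rw [← capelliDet_eq_columnDet] at h
  have := congrArg (fun P => P.coeff k) h.eq
  rw [commute_iff_eq]
  simpa only [coeff_C_mul, coeff_mul_C] using this.symm

theorem commute_of_commute_genMatrix (z : U n) (hz : ∀ a b, Commute z (genMatrix n a b)) (y : U n) :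
    Commute z y := by
  have hx : ∀ x : gl n, UniversalEnvelopingAlgebra.ι ℂ x ∈ Subalgebra.centralizer ℂ {z} := by
    intro x
    rw [Matrix.matrix_eq_sum_single x, map_sum]
    refine sum_mem fun i _ => ?_
    rw [map_sum]
    refine sum_mem fun j _ => ?_
    have : Matrix.single i j (x i j) = x i j • (Matrix.single i j (1 : ℂ) : gl n) := by simp
    rw [this, map_smul]
    refine Subalgebra.smul_mem _ ?_ _
    rw [Subalgebra.mem_centralizer_iff]
    rintro _ rfl
    exact hz i j
  let f : gl n →ₗ⁅ℂ⁆ Subalgebra.centralizer ℂ {z} :=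
    { toFun := fun x => ⟨_, hx x⟩
      map_add' := fun x y => Subtype.ext (map_add _ x y)
      map_smul' := fun c x => Subtype.ext (map_smul _ c x)
      map_lie' := fun {x y} => Subtype.ext (LieHom.map_lie _ x y) }
  -- The identity of `U n` factors through the centralizer of `z`, by uniqueness in the universal
  -- property.
  have h : (Subalgebra.val _).comp (UniversalEnvelopingAlgebra.lift ℂ f) = AlgHom.id ℂ (U n) := by
    ext x
    simp only [LieHom.comp_apply, AlgHom.coe_toLieHom, AlgHom.comp_apply,
      UniversalEnvelopingAlgebra.lift_ι_apply]
    rfl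
  have hy : y ∈ Subalgebra.centralizer ℂ {z} := by
    have := congrArg (fun g => g y) h
    simp only [AlgHom.comp_apply, AlgHom.id_apply] at this
    rw [← this]
    exact Subtype.property _
  exact (Subalgebra.mem_centralizer_iff ℂ).mp hy z rfl

theorem commute_coeff_capelliDet (k : ℕ) (y : U n) : Commute ((capelliDet n).coeff k) y :=
  commute_of_commute_genMatrix n _ (commute_coeff_capelliDet_genMatrix n k) y

theorem evalMatrix_capelliDet_neg_add :
    evalMatrix (capelliDet n) (-genMatrix n + (n : Matrix (Fin n) (Fin n) (U n)) - 1) = 0 := by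
  cases n with
  | zero => exact Subsingleton.elim _ _
  | succ n =>
    refine eval₂_scalar_eq_zero_of_mul_sub _ (Matrix.of fun l i =>
      ((Equiv.Perm.sign (Equiv.swap (Fin.last n) l) : ℤ) : (U (n + 1))[X]) *
        columnCofactor (fun k : Fin (n + 1) => shiftedMatrix (n + 1) k)
          (Equiv.swap (Fin.last n) l) (Fin.last n) i) _ ?_
    -- The size is now `n + 1`, so `u - A` is `u + E - n`, the matrix used for the last column.
    have e : Matrix.scalar (Fin (n + 1)) X - (C : U (n + 1) →+* (U (n + 1))[X]).mapMatrix
        (-genMatrix (n + 1) + ((n + 1 : ℕ) : Matrix (Fin (n + 1)) (Fin (n + 1)) (U (n + 1))) - 1) =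
        shiftedMatrix (n + 1) n := by
      rw [map_sub, map_add, map_neg, map_natCast, map_one, shiftedMatrix, RingHom.mapMatrix_apply]
      push_cast
      abel
    rw [e]
    ext1 l j
    have h := columnDet_update_swap _ (shiftedMatrix_exchange (n + 1)) (Fin.last n) l j
    rw [columnDet_eq_sum_last] at h
    simp only [columnCofactor_update, Function.update_self, Fin.val_last, Finset.mul_sum] at h
    rw [Matrix.mul_apply, Matrix.scalar_apply, Matrix.diagonal_apply]
    simp only [Matrix.of_apply, mul_assoc]
    rw [h, capelliDet_eq_columnDet]
    simp only [eq_comm]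

theorem evalMatrix_capelliDet_neg_transpose :
    evalMatrix (capelliDet n) (-(genMatrix n)ᵀ) = 0 := by
  cases n with
  | zero => exact Subsingleton.elim _ _
  | succ n =>
    refine eval₂_scalar_eq_zero_of_sub_mul _ (Matrix.of fun i l =>
      ((Equiv.Perm.sign (Equiv.swap 0 l) : ℤ) : (U (n + 1))[X]) *
        columnCofactor (fun k : Fin (n + 1) => shiftedMatrix (n + 1) k)
          (Equiv.swap 0 l) 0 i) _ (commute_coeff_capelliDet _) ?_
    have e : Matrix.scalar (Fin (n + 1)) X - (C : U (n + 1) →+* (U (n + 1))[X]).mapMatrix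
        (-(genMatrix (n + 1))ᵀ) = (shiftedMatrix (n + 1) 0)ᵀ := by
      rw [map_neg, shiftedMatrix, RingHom.mapMatrix_apply, sub_neg_eq_add, Nat.cast_zero, sub_zero,
        Matrix.transpose_add, Matrix.scalar_apply, Matrix.diagonal_transpose, Matrix.transpose_map]
    rw [e]
    ext1 j l
    have h := columnDet_update_swap _ (shiftedMatrix_exchange (n + 1)) 0 l j
    rw [columnDet_eq_sum_zero] at h
    simp only [columnCofactor_update, Function.update_self, Fin.val_zero, Finset.mul_sum] at h
    rw [Matrix.mul_apply, Matrix.scalar_apply, Matrix.diagonal_apply]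
    simp only [Matrix.of_apply, Matrix.transpose_apply]
    rw [capelliDet_eq_columnDet, ← h]
    refine Finset.sum_congr rfl fun i _ => ?_
    rw [← mul_assoc, ← mul_assoc, (Int.cast_commute _ _).eq]

end Capelli

/-! ### Action on highest weight representations -/

section HighestWeight

variable {n : ℕ} {V : Type*} [AddCommGroup V] [Module ℂ V]

/-- Coefficientwise, the polynomial `P` acts on the vector `v` as the scalar polynomial `S`. -/
def ActsAs {R : Type*} [Semiring R] (ρ : R →+* Module.End ℂ V) (v : V) (P : R[X]) (S : ℂ[X]) :
    Prop :=
  ∀ k, ρ (P.coeff k) v = S.coeff k • v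

namespace ActsAs

variable {R : Type*} [Ring R] {ρ : R →+* Module.End ℂ V} {v : V} {P Q : R[X]} {S T : ℂ[X]}

theorem mul (hP : ActsAs ρ v P S) (hQ : ActsAs ρ v Q T) : ActsAs ρ v (P * Q) (S * T) := by
  intro k
  simp only [coeff_mul, map_sum, map_mul, LinearMap.sum_apply, Module.End.mul_apply, hQ _, map_smul,
    hP _, Finset.sum_smul, smul_smul]
  exact Finset.sum_congr rfl fun x _ => by rw [mul_comm]

theorem mul_zero (hQ : ActsAs ρ v Q 0) : ActsAs ρ v (P * Q) 0 := by
  intro k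
  have h : ∀ m, ρ (Q.coeff m) v = 0 := fun m => by simpa using hQ m
  simp only [coeff_mul, map_sum, map_mul, LinearMap.sum_apply, Module.End.mul_apply, h, map_zero,
    Finset.sum_const_zero, coeff_zero, zero_smul]

theorem one : ActsAs ρ v (1 : R[X]) 1 := by
  intro k
  simp only [coeff_one]
  split_ifs <;> simp

theorem sum {ι : Type*} (s : Finset ι) {P : ι → R[X]} {S : ι → ℂ[X]}
    (h : ∀ i ∈ s, ActsAs ρ v (P i) (S i)) : ActsAs ρ v (∑ i ∈ s, P i) (∑ i ∈ s, S i) := by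
  intro k
  simp only [finsetSum_coeff, map_sum, LinearMap.sum_apply, Finset.sum_smul]
  exact Finset.sum_congr rfl fun i hi => h i hi k

theorem prod_ofFn : ∀ {n : ℕ} {P : Fin n → R[X]} {S : Fin n → ℂ[X]},
    (∀ i, ActsAs ρ v (P i) (S i)) → ActsAs ρ v (List.ofFn P).prod (List.ofFn S).prod
  | 0, _, _, _ => by simpa using one
  | n + 1, P, S, h => by
    rw [List.ofFn_succ, List.ofFn_succ, List.prod_cons, List.prod_cons]
    exact (h 0).mul (prod_ofFn fun i => h i.succ)

/-- The rightmost factors act first and only rescale `v`; factor `k` then kills it, whatever stands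
to its left. -/
theorem prod_ofFn_eq_zero : ∀ {n : ℕ} {P : Fin n → R[X]} {S : Fin n → ℂ[X]} (k : Fin n),
    ActsAs ρ v (P k) 0 → (∀ i, k < i → ActsAs ρ v (P i) (S i)) →
      ActsAs ρ v (List.ofFn P).prod 0
  | 0, _, _, k, _, _ => k.elim0
  | n + 1, P, S, k, hk, h => by
    rw [List.ofFn_succ, List.prod_cons]
    induction k using Fin.cases with
    | zero =>
      have := hk.mul (prod_ofFn (P := fun i : Fin n => P i.succ) fun i => h i.succ (Fin.succ_pos i))
      rwa [zero_mul] at this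
    | succ k =>
      exact (prod_ofFn_eq_zero (S := fun i => S i.succ) k hk
        fun i hi => h i.succ (Fin.succ_lt_succ_iff.mpr hi)).mul_zero

end ActsAs

/-- Take the largest moved point: larger points are fixed, so injectivity forces its image below it.
This supplies the raising operator that kills the term of `p`. -/
theorem exists_perm_apply_lt {p : Equiv.Perm (Fin n)} (hp : p ≠ 1) :
    ∃ k, p k < k ∧ ∀ i, k < i → p i = i := by
  have hs : (Finset.univ.filter fun k => p k ≠ k).Nonempty := by
    by_contra h
    refine hp (Equiv.ext fun k => ?_)
    by_contra hk
    exact h ⟨k, by simpa using hk⟩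
  set k := (Finset.univ.filter fun k => p k ≠ k).max' hs with hkdef
  have hk : p k ≠ k := by simpa using Finset.max'_mem _ hs
  have hi : ∀ i, k < i → p i = i := fun i hi => by
    by_contra h
    exact absurd (Finset.le_max' _ i (by simpa using h)) (not_le.mpr hi)
  refine ⟨k, lt_of_le_of_ne (not_lt.mp fun h => hk (p.injective (hi _ h))) hk, hi⟩

/-- The action of the enveloping algebra on a vector which the matrix units above the diagonal
annihilate and for which the diagonal ones have eigenvalues `lam i`. -/
theorem actsAs_capelliDet (ρ : U n →+* Module.End ℂ V) (v : V) (lam : Fin n → ℂ)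
    (hlt : ∀ i j, i < j → ρ (genMatrix n i j) v = 0)
    (hdiag : ∀ i, ρ (genMatrix n i i) v = lam i • v) :
    ActsAs ρ v (capelliDet n) (List.ofFn fun i => X + C (shiftedWeight lam i)).prod := by
  have hM : ∀ i : Fin n, ActsAs ρ v (shiftedMatrix n i i i) (X + C (shiftedWeight lam i)) := by
    intro i k
    have e : shiftedMatrix n i i i = X + C (genMatrix n i i - ((i : ℕ) : U n)) := by
      rw [shiftedMatrix_apply, if_pos rfl, Matrix.map_apply, C_sub, C_eq_natCast,
        add_sub_left_comm]
    rw [e, coeff_add, coeff_add, coeff_X, coeff_X, coeff_C, coeff_C, map_add, LinearMap.add_apply,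
      add_smul, shiftedWeight]
    have h2 : ρ (genMatrix n i i - ((i : ℕ) : U n)) v = (lam i - ((i : ℕ) + 1 : ℂ) + 1) • v := by
      rw [map_sub, map_natCast, LinearMap.sub_apply, hdiag, Module.End.natCast_apply,
        ← Nat.cast_smul_eq_nsmul ℂ, ← sub_smul]
      congr 1
      ring
    congr 1
    · split_ifs <;> simp
    · split_ifs
      · exact h2
      · simp
  have hne : ∀ i j : Fin n, i < j → ActsAs ρ v (shiftedMatrix n j i j) 0 := by
    intro i j hij k
    rw [shiftedMatrix_apply, if_neg hij.ne, add_zero, Matrix.map_apply, coeff_C]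
    split_ifs <;> simp [hlt i j hij]
  have h1 : (List.ofFn fun i => X + C (shiftedWeight lam i)).prod =
      ∑ p : Equiv.Perm (Fin n),
        if p = 1 then (List.ofFn fun i => X + C (shiftedWeight lam i)).prod else 0 := by simp
  rw [h1]
  refine ActsAs.sum _ fun p _ => ?_
  split_ifs with hp
  · subst hp
    simpa using ActsAs.prod_ofFn hM
  · obtain ⟨k, hk, hi⟩ := exists_perm_apply_lt hp
    have h0 : ActsAs ρ v (entryProd (fun k : Fin n => shiftedMatrix n k) p id) 0 := by
      refine ActsAs.prod_ofFn_eq_zero (P := fun i => shiftedMatrix n i (p i) i)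
        (S := fun i => X + C (shiftedWeight lam i)) k (hne _ _ hk) fun i h => ?_
      simpa only [hi i h] using hM i
    exact h0.mul_zero

variable [LieRingModule (gl n) V] [LieModule ℂ (gl n) V]

theorem lift_toEnd_genMatrix (i j : Fin n) (v : V) :
    UniversalEnvelopingAlgebra.lift ℂ (LieModule.toEnd ℂ (gl n) V) (genMatrix n i j) v =
      ⁅(Matrix.single i j (1 : ℂ) : gl n), v⁆ := by
  rw [genMatrix, Matrix.of_apply, UniversalEnvelopingAlgebra.lift_ι_apply]
  rfl

/-- A central element that acts as a scalar on a generating vector acts as that scalar. -/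
theorem lift_toEnd_eq_algebraMap (z : U n) (hz : ∀ y, Commute z y) (c : ℂ) (v : V)
    (hv : LieSubmodule.lieSpan ℂ (gl n) {v} = ⊤)
    (hc : UniversalEnvelopingAlgebra.lift ℂ (LieModule.toEnd ℂ (gl n) V) z v = c • v) :
    UniversalEnvelopingAlgebra.lift ℂ (LieModule.toEnd ℂ (gl n) V) z =
      algebraMap ℂ (Module.End ℂ V) c := by
  set ρ := UniversalEnvelopingAlgebra.lift ℂ (LieModule.toEnd ℂ (gl n) V) with hρ
  let N : LieSubmodule ℂ (gl n) V :=
    { LinearMap.eqLocus (ρ z) (algebraMap ℂ (Module.End ℂ V) c) with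
      lie_mem := by
        intro x w hw
        have hw : ρ z w = algebraMap ℂ (Module.End ℂ V) c w := hw
        have hx : ∀ w : V, ⁅x, w⁆ = ρ (UniversalEnvelopingAlgebra.ι ℂ x) w := fun w => by
          rw [hρ, UniversalEnvelopingAlgebra.lift_ι_apply]; rfl
        change ρ z ⁅x, w⁆ = algebraMap ℂ (Module.End ℂ V) c ⁅x, w⁆
        rw [hx, ← Module.End.mul_apply, ← map_mul, (hz _).eq, map_mul, Module.End.mul_apply, hw]
        simp }
  have hN : N = ⊤ := by
    rw [eq_top_iff, ← hv, LieSubmodule.lieSpan_le, Set.singleton_subset_iff]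
    change ρ z v = algebraMap ℂ (Module.End ℂ V) c v
    simpa using hc
  ext w
  exact (hN ▸ LieSubmodule.mem_top w : w ∈ N)

/-- A relation for matrices over the enveloping algebra, in a highest weight representation. -/
theorem prod_map_add_algebraMap_eq_zero (lam : Fin n → ℂ) (h : IsHighestWeightRep V lam)
    (A : Matrix (Fin n) (Fin n) (U n)) (hA : evalMatrix (capelliDet n) A = 0) :
    (List.ofFn fun i : Fin n =>
      A.map (UniversalEnvelopingAlgebra.lift ℂ (LieModule.toEnd ℂ (gl n) V)) +
        algebraMap ℂ (Matrix (Fin n) (Fin n) (Module.End ℂ V)) (shiftedWeight lam i)).prod = 0 := by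
  obtain ⟨v, -, hlt, hdiag, hspan⟩ := h
  set ρ := UniversalEnvelopingAlgebra.lift ℂ (LieModule.toEnd ℂ (gl n) V) with hρ
  have hact := actsAs_capelliDet (ρ : U n →+* Module.End ℂ V) v lam
    (fun i j hij => by simpa only [RingHom.coe_coe, hρ, lift_toEnd_genMatrix] using hlt i j hij)
    (fun i => by simpa only [RingHom.coe_coe, hρ, lift_toEnd_genMatrix] using hdiag i)
  set S : ℂ[X] := (List.ofFn fun i => X + C (shiftedWeight lam i)).prod with hS
  have hmap : (capelliDet n).map (ρ : U n →+* Module.End ℂ V) =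
      S.map (algebraMap ℂ (Module.End ℂ V)) := by
    ext1 k
    rw [coeff_map, coeff_map]
    exact lift_toEnd_eq_algebraMap _ (commute_coeff_capelliDet n k) _ v hspan (hact k)
  have h1 := congrArg (fun B => (ρ : U n →+* Module.End ℂ V).mapMatrix B) hA
  simp only [evalMatrix, map_zero] at h1
  have hcomp : ((ρ : U n →+* Module.End ℂ V).mapMatrix).comp (Matrix.scalar (Fin n)) =
      (Matrix.scalar (Fin n)).comp (ρ : U n →+* Module.End ℂ V) := by
    ext x i j
    simp [Matrix.diagonal_apply, apply_ite ρ]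
  have halg : (Matrix.scalar (Fin n)).comp (algebraMap ℂ (Module.End ℂ V)) =
      algebraMap ℂ (Matrix (Fin n) (Fin n) (Module.End ℂ V)) := rfl
  -- Once the coefficients are complex scalars, evaluation at the matrix is multiplicative and the
  -- product splits.
  rw [hom_eval₂, hcomp, ← eval₂_map, hmap, eval₂_map, halg, ← aeval_def, hS, map_list_prod,
    List.map_ofFn] at h1
  rw [← h1]
  congr 2
  funext i
  simp [RingHom.mapMatrix_apply]

theorem prod_ofFn_neg_eq_zero {R : Type*} [Ring R] {m : ℕ} {f : Fin m → R}
    (h : (List.ofFn f).prod = 0) : (List.ofFn fun i => -f i).prod = 0 := by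
  have key : ∀ l : List R, (l.map Neg.neg).prod = (-1) ^ l.length * l.prod := by
    intro l
    induction l with
    | nil => simp
    | cons a l ih =>
      rw [List.map_cons, List.prod_cons, ih, List.prod_cons, List.length_cons, pow_succ', neg_mul,
        ← mul_assoc, ((Commute.neg_one_right a).pow_right _).eq, neg_one_mul, neg_mul, mul_assoc]
  have := key (List.ofFn f)
  rwa [h, mul_zero, List.map_ofFn] at this

end HighestWeight

end CapelliCH

theorem mainTheorem12 (n : ℕ) :
    (∀ k : ℕ, (CapelliCH.capelliDet n).coeff k ∈
      Subalgebra.center ℂ (CapelliCH.U n)) ∧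
    CapelliCH.evalMatrix (CapelliCH.capelliDet n)
      (-CapelliCH.genMatrix n + (n : Matrix (Fin n) (Fin n) (CapelliCH.U n)) - 1) = 0 ∧
    CapelliCH.evalMatrix (CapelliCH.capelliDet n) (-(CapelliCH.genMatrix n)ᵀ) = 0 ∧
    ∀ (V : Type*) [AddCommGroup V] [Module ℂ V] [LieRingModule (CapelliCH.gl n) V]
      [LieModule ℂ (CapelliCH.gl n) V] (lam : Fin n → ℂ),
      CapelliCH.IsHighestWeightRep V lam →
      (List.ofFn fun i : Fin n =>
        CapelliCH.genMatrixOn V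
          - algebraMap ℂ (Matrix (Fin n) (Fin n) (Module.End ℂ V)) (CapelliCH.shiftedWeight lam i)
          - (n : Matrix (Fin n) (Fin n) (Module.End ℂ V)) + 1).prod = 0 ∧
      (List.ofFn fun i : Fin n =>
        (CapelliCH.genMatrixOn V)ᵀ
          - algebraMap ℂ (Matrix (Fin n) (Fin n) (Module.End ℂ V))
              (CapelliCH.shiftedWeight lam i)).prod = 0 := by
  refine ⟨fun k => ?_, CapelliCH.evalMatrix_capelliDet_neg_add n,
    CapelliCH.evalMatrix_capelliDet_neg_transpose n, ?_⟩
  · exact Subalgebra.mem_center_iff.mpr fun y => (CapelliCH.commute_coeff_capelliDet n k y).eq.symm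
  · intro V _ _ _ _ lam h
    let ρ : CapelliCH.U n →+* Module.End ℂ V :=
      (UniversalEnvelopingAlgebra.lift ℂ (LieModule.toEnd ℂ (CapelliCH.gl n) V) :)
    have hE : CapelliCH.genMatrixOn V = ρ.mapMatrix (CapelliCH.genMatrix n) := rfl
    have h1 := CapelliCH.prod_map_add_algebraMap_eq_zero lam h _
      (CapelliCH.evalMatrix_capelliDet_neg_add n)
    have h2 := CapelliCH.prod_map_add_algebraMap_eq_zero lam h _
      (CapelliCH.evalMatrix_capelliDet_neg_transpose n)
    have e1 : Matrix.map (-CapelliCH.genMatrix n + (n : Matrix (Fin n) (Fin n) (CapelliCH.U n)) - 1)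
        (UniversalEnvelopingAlgebra.lift ℂ (LieModule.toEnd ℂ (CapelliCH.gl n) V)) =
        -CapelliCH.genMatrixOn V + (n : Matrix (Fin n) (Fin n) (Module.End ℂ V)) - 1 := by
      change ρ.mapMatrix _ = _
      rw [map_sub, map_add, map_neg, map_natCast, map_one, hE]
    have e2 : Matrix.map (-(CapelliCH.genMatrix n)ᵀ)
        (UniversalEnvelopingAlgebra.lift ℂ (LieModule.toEnd ℂ (CapelliCH.gl n) V)) =
        -(CapelliCH.genMatrixOn V)ᵀ := by
      change ρ.mapMatrix _ = _
      rw [map_neg]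
      rfl
    rw [e1] at h1
    rw [e2] at h2
    -- The factors obtained are `A + l_i` with `A = -E + n - 1` or `A = -Eᵗ`; negating each one
    -- gives the stated form.
    constructor
    · rw [← CapelliCH.prod_ofFn_neg_eq_zero h1]
      congr 2
      funext i
      abel
    · rw [← CapelliCH.prod_ofFn_neg_eq_zero h2]
      congr 2
      funext i
      abel
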